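/- Let $\phi\in L^2(\mathbf R)$ with $\|\phi\|=1$, and for $(\tau,\sigma)\in\mathbf R^2$ let $\rho(\tau,\sigma)\phi(t)=e^{\pi i\tau\sigma}e^{2\pi i\sigma t}\phi(t+\tau)$. For $f\in L^2(\mathbf R)$ let $\mathcal S_\phi f(\tau,\sigma)=\langle f,\rho(\tau,\sigma)\phi\rangle=\int_{\mathbf R} f(t)\,\overline{\rho(\tau,\sigma)\phi(t)}\,dt$ be its Gabor transform. For a bounded measurable set $\Omega\subset\mathbf R^2$ let $\mathcal C_\Omega$ be the concentration operator, i.e. the unique bounded operator on $L^2(\mathbf R)$ such that $$\langle \mathcal C_\Omega f,g\rangle=\iint_\Omega \mathcal S_\phi f(\tau,\sigma)\,\overline{\mathcal S_\phi g(\tau,\sigma)}\,d\tau\,d\sigma\qquad\text{for all } f,g\in L^2(\mathbf R).$$ For real $\lambda$, let $n(\lambda,\Omega)$ be the number of eigenvalues of $\mathcal C_\Omega$ that are $\ge\lambda$, counted with multiplicity, and for $r>0$ let $\Omega_r=\{(r\tau,r\sigma):(\tau,\sigma)\in\Omega\}$. Theorem. Let $\Omega\subset\mathbf R^2$ be a bounded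 measurable set of positive area and let $0<\lambda<1$. Then $$\liminf_{r\to\infty}\frac{n(\lambda,\Omega_r)}{\mathrm{area}(\Omega_r)}=1 .$$ -/

import Mathlib

open MeasureTheory Filter
open scoped ENNReal Pointwise ComplexConjugate

/-- The complex Hilbert space `L²(ℝ)` of signals. -/
abbrev SignalSpace : Type := Lp ℂ 2 (volume : Measure ℝ)

/-- The time-frequency shift
`ρ(τ, σ) f (t) = exp (π i τ σ) exp (2 π i σ t) f (t + τ)`. -/
noncomputable def timeFreqShift (τ σ : ℝ) (f : ℝ → ℂ) (t : ℝ) : ℂ :=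
  Complex.exp (Real.pi * Complex.I * τ * σ) * Complex.exp (2 * Real.pi * Complex.I * σ * t)
    * f (t + τ)

/-- The Gabor transform `S_φ f (τ, σ) = ⟨f, ρ(τ, σ) φ⟩ = ∫ f(t) conj (ρ(τ, σ) φ (t)) dt`. -/
noncomputable def gaborTransform (φ f : SignalSpace) (p : ℝ × ℝ) : ℂ :=
  ∫ t : ℝ, f t * conj (timeFreqShift p.1 p.2 φ t)

/-- The Hermitian form `E_Ω(f, g) = ∬_Ω S_φ f · conj (S_φ g)`, the energy of the
Gabor transform inside `Ω`. -/
noncomputable def concentrationForm (φ : SignalSpace) (Ω : Set (ℝ × ℝ)) (f g : SignalSpace) : ℂ :=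
  ∫ p in Ω, gaborTransform φ f p * conj (gaborTransform φ g p)

lemma norm_timeFreqShift (τ σ : ℝ) (f : ℝ → ℂ) (t : ℝ) :
    ‖timeFreqShift τ σ f t‖ = ‖f (t + τ)‖ := by
  have h1 : (Real.pi * Complex.I * τ * σ : ℂ) = ((Real.pi * τ * σ : ℝ) : ℂ) * Complex.I := by
    push_cast; ring
  have h2 : (2 * Real.pi * Complex.I * σ * t : ℂ)
      = ((2 * Real.pi * σ * t : ℝ) : ℂ) * Complex.I := by
    push_cast; ring
  simp only [timeFreqShift, norm_mul]
  rw [h1, h2, Complex.norm_exp_ofReal_mul_I, Complex.norm_exp_ofReal_mul_I]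
  simp

lemma memLp_timeFreqShift (τ σ : ℝ) (φ : SignalSpace) :
    MemLp (timeFreqShift τ σ φ) 2 volume := by
  have h : MemLp (fun t => (φ : ℝ → ℂ) (t + τ)) 2 volume :=
    (Lp.memLp φ).comp_measurePreserving (measurePreserving_add_right volume τ)
  refine (memLp_congr_norm ?_ h.1 (Eventually.of_forall fun t => norm_timeFreqShift τ σ φ t)).2 h
  unfold timeFreqShift
  exact (Continuous.aestronglyMeasurable (by fun_prop)).mul h.1

/-- The time-frequency shift of a signal, as an element of `L²(ℝ)`. -/
noncomputable def shiftLp (φ : SignalSpace) (p : ℝ × ℝ) : SignalSpace :=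
  (memLp_timeFreqShift p.1 p.2 φ).toLp _

lemma norm_shiftLp (φ : SignalSpace) (p : ℝ × ℝ) : ‖shiftLp φ p‖ = ‖φ‖ := by
  rw [shiftLp, Lp.norm_toLp, Lp.norm_def]
  congr 1
  rw [eLpNorm_congr_norm_ae (g := fun t => (φ : ℝ → ℂ) (t + p.1))
    (Eventually.of_forall fun t => norm_timeFreqShift p.1 p.2 φ t)]
  exact eLpNorm_comp_measurePreserving (Lp.memLp φ).1 (measurePreserving_add_right volume p.1)

lemma gaborTransform_eq_inner (φ f : SignalSpace) (p : ℝ × ℝ) :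
    gaborTransform φ f p = inner ℂ (shiftLp φ p) f := by
  rw [L2.inner_def, gaborTransform]
  refine integral_congr_ae ?_
  filter_upwards [(memLp_timeFreqShift p.1 p.2 φ).coeFn_toLp] with t ht
  simp only [shiftLp, RCLike.inner_apply, ht]

lemma norm_gaborTransform_le (φ f : SignalSpace) (p : ℝ × ℝ) :
    ‖gaborTransform φ f p‖ ≤ ‖φ‖ * ‖f‖ := by
  rw [gaborTransform_eq_inner, ← norm_shiftLp φ p]
  exact norm_inner_le_norm _ _

lemma stronglyMeasurable_gaborTransform (φ f : SignalSpace) :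
    StronglyMeasurable (gaborTransform φ f) := by
  have hφ := (Lp.stronglyMeasurable φ).measurable
  have hf := (Lp.stronglyMeasurable f).measurable
  refine StronglyMeasurable.integral_prod_right (ν := (volume : Measure ℝ))
    (f := fun (p : ℝ × ℝ) (t : ℝ) => (f : ℝ → ℂ) t * conj (timeFreqShift p.1 p.2 φ t)) ?_
  refine Measurable.stronglyMeasurable ?_
  unfold timeFreqShift
  have h1 : Measurable fun q : (ℝ × ℝ) × ℝ => (f : ℝ → ℂ) q.2 := hf.comp measurable_snd
  have h2 : Measurable fun q : (ℝ × ℝ) × ℝ => (φ : ℝ → ℂ) (q.2 + q.1.1) :=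
    hφ.comp (by fun_prop)
  have h3 : Measurable fun q : (ℝ × ℝ) × ℝ =>
      Complex.exp (Real.pi * Complex.I * q.1.1 * q.1.2)
        * Complex.exp (2 * Real.pi * Complex.I * q.1.2 * q.2) :=
    Continuous.measurable (by fun_prop)
  exact h1.mul (Complex.continuous_conj.measurable.comp (h3.mul h2))

lemma norm_concentration_le (φ f g : SignalSpace) (p : ℝ × ℝ) :
    ‖gaborTransform φ f p * conj (gaborTransform φ g p)‖ ≤ ‖φ‖ * ‖f‖ * (‖φ‖ * ‖g‖) := by
  rw [norm_mul, RCLike.norm_conj]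
  exact mul_le_mul (norm_gaborTransform_le φ f p) (norm_gaborTransform_le φ g p)
    (norm_nonneg _) (by positivity)

lemma integrableOn_concentration (φ : SignalSpace) {Ω : Set (ℝ × ℝ)}
    (hΩ : Bornology.IsBounded Ω) (f g : SignalSpace) :
    IntegrableOn (fun p => gaborTransform φ f p * conj (gaborTransform φ g p)) Ω := by
  refine IntegrableOn.of_bound hΩ.measure_lt_top ?_ (‖φ‖ * ‖f‖ * (‖φ‖ * ‖g‖))
    (Eventually.of_forall (norm_concentration_le φ f g))
  exact ((stronglyMeasurable_gaborTransform φ f).mul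
    (Complex.continuous_conj.comp_stronglyMeasurable
      (stronglyMeasurable_gaborTransform φ g))).aestronglyMeasurable

lemma concentrationForm_conj (φ : SignalSpace) (Ω : Set (ℝ × ℝ)) (f g : SignalSpace) :
    conj (concentrationForm φ Ω f g) = concentrationForm φ Ω g f := by
  rw [concentrationForm, concentrationForm, ← integral_conj]
  refine integral_congr_ae (Eventually.of_forall fun p => ?_)
  simp [mul_comm]

lemma concentrationForm_add_left (φ : SignalSpace) {Ω : Set (ℝ × ℝ)}
    (hΩ : Bornology.IsBounded Ω) (f₁ f₂ g : SignalSpace) :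
    concentrationForm φ Ω (f₁ + f₂) g = concentrationForm φ Ω f₁ g + concentrationForm φ Ω f₂ g := by
  rw [concentrationForm, concentrationForm, concentrationForm,
    ← integral_add (integrableOn_concentration φ hΩ f₁ g) (integrableOn_concentration φ hΩ f₂ g)]
  refine integral_congr_ae (Eventually.of_forall fun p => ?_)
  simp only [gaborTransform_eq_inner, inner_add_right, add_mul]

lemma concentrationForm_smul_left (φ : SignalSpace) (Ω : Set (ℝ × ℝ)) (c : ℂ)
    (f g : SignalSpace) :
    concentrationForm φ Ω (c • f) g = c * concentrationForm φ Ω f g := by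
  rw [concentrationForm, concentrationForm, ← integral_const_mul]
  refine integral_congr_ae (Eventually.of_forall fun p => ?_)
  simp only [gaborTransform_eq_inner, inner_smul_right, mul_assoc]

lemma norm_concentrationForm_le (φ : SignalSpace) {Ω : Set (ℝ × ℝ)}
    (hΩ : Bornology.IsBounded Ω) (f g : SignalSpace) :
    ‖concentrationForm φ Ω f g‖ ≤ ‖φ‖ * ‖φ‖ * volume.real Ω * ‖g‖ * ‖f‖ := by
  refine (norm_setIntegral_le_of_norm_le_const hΩ.measure_lt_top
    (fun p _ => norm_concentration_le φ f g p)).trans (le_of_eq ?_)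
  ring

/-- On a bounded region the form `E_Ω` is represented by a unique bounded operator. -/
theorem existsUnique_concentrationOp (φ : SignalSpace) {Ω : Set (ℝ × ℝ)}
    (hΩ : Bornology.IsBounded Ω) :
    ∃! C : SignalSpace →L[ℂ] SignalSpace,
      ∀ f g : SignalSpace, inner ℂ g (C f) = concentrationForm φ Ω f g := by
  let B : SignalSpace →ₗ⋆[ℂ] SignalSpace →ₗ[ℂ] ℂ :=
    LinearMap.mk₂'ₛₗ (starRingEnd ℂ) (RingHom.id ℂ) (fun v w => concentrationForm φ Ω w v)
      (fun v₁ v₂ w => by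
        rw [← concentrationForm_conj φ Ω (v₁ + v₂) w, concentrationForm_add_left φ hΩ, map_add,
          concentrationForm_conj, concentrationForm_conj])
      (fun c v w => by
        rw [← concentrationForm_conj φ Ω (c • v) w, concentrationForm_smul_left, map_mul,
          concentrationForm_conj, smul_eq_mul])
      (fun v w₁ w₂ => concentrationForm_add_left φ hΩ w₁ w₂ v)
      (fun c v w => concentrationForm_smul_left φ Ω c w v)
  let B' : SignalSpace →L⋆[ℂ] SignalSpace →L[ℂ] ℂ :=
    B.mkContinuous₂ (‖φ‖ * ‖φ‖ * volume.real Ω)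
      (fun v w => norm_concentrationForm_le φ hΩ w v)
  refine ⟨InnerProductSpace.continuousLinearMapOfBilin B', fun f g => ?_, fun C hC => ?_⟩
  · rw [← inner_conj_symm, InnerProductSpace.continuousLinearMapOfBilin_apply]
    exact concentrationForm_conj φ Ω g f
  · ext1 f
    refine InnerProductSpace.unique_continuousLinearMapOfBilin B' fun g => ?_
    rw [← inner_conj_symm, hC]
    exact concentrationForm_conj φ Ω f g

open Classical in
/-- The concentration operator `C_Ω`: the bounded operator on `L²(ℝ)` with
`⟨C_Ω f, g⟩ = E_Ω(f, g)` for all `f, g` (Mathlib's inner product is linear in its second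
argument). By `existsUnique_concentrationOp` it exists and is unique for every bounded `Ω`. -/
noncomputable def concentrationOp (φ : SignalSpace) (Ω : Set (ℝ × ℝ)) :
    SignalSpace →L[ℂ] SignalSpace :=
  if h : ∃ C : SignalSpace →L[ℂ] SignalSpace,
      ∀ f g : SignalSpace, inner ℂ g (C f) = concentrationForm φ Ω f g
  then h.choose else 0

theorem concentrationOp_spec (φ : SignalSpace) {Ω : Set (ℝ × ℝ)}
    (hΩ : Bornology.IsBounded Ω) (f g : SignalSpace) :
    inner ℂ g (concentrationOp φ Ω f) = concentrationForm φ Ω f g := by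
  have h := (existsUnique_concentrationOp φ hΩ).exists
  rw [concentrationOp, dif_pos h]
  exact h.choose_spec f g

/-- The multiplicity of the real number `μ` as an eigenvalue of `C_Ω`, i.e. the (possibly
infinite) dimension of `ker (C_Ω - μ)`; it is `0` if `μ` is not an eigenvalue. -/
noncomputable def eigenvalueMultiplicity (φ : SignalSpace) (Ω : Set (ℝ × ℝ)) (μ : ℝ) : ℕ∞ :=
  Cardinal.toENat (Module.rank ℂ
    (Module.End.eigenspace (concentrationOp φ Ω : SignalSpace →ₗ[ℂ] SignalSpace) (μ : ℂ)))

/-- `n(lam, Ω)`: the number of eigenvalues `≥ lam` of `C_Ω`, counted with multiplicity. -/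
noncomputable def eigenvalueCount (φ : SignalSpace) (lam : ℝ) (Ω : Set (ℝ × ℝ)) : ℝ≥0∞ :=
  ∑' μ : Set.Ici lam, (eigenvalueMultiplicity φ Ω μ : ℝ≥0∞)

/-! `C_Ω = ∫_Ω ⟨ρ(p)φ, ·⟩ ρ(p)φ dp` is the frame operator of the coherent states `ρ(p)φ`, `p ∈ Ω`,
hence compact and self-adjoint. By Moyal's identity `∬ |S_φ f|² = ‖φ‖² ‖f‖²` its eigenvalues
`νᵢ` lie in `[0, 1]`; taking the trace of `C_Ω` and of its square, `∑ νᵢ = area Ω` and `∑ νᵢ² =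
∬_{Ω × Ω} |S_φ φ (q - p)|² dp dq`. On `[0, 1]` the function `x - x²` controls the distance from
`x` to the indicator of `[lam, ∞)` up to the factor `(lam (1 - lam))⁻¹`, so the number of
eigenvalues `≥ lam` differs from `area Ω` by at most a constant times `∑ (νᵢ - νᵢ²)`. For `r Ω`
the quotient of the double integral by the area tends to `∬ |S_φ φ|² = 1`, because a fixed
translation moves an ever smaller fraction of `r Ω` out of `r Ω`; hence `∑ (νᵢ - νᵢ²) = o(area
(r Ω))`. -/

section Plancherel

open scoped FourierTransform SchwartzMap

variable {V F : Type*} [NormedAddCommGroup V] [InnerProductSpace ℝ V] [FiniteDimensional ℝ V]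
  [MeasurableSpace V] [BorelSpace V] [NormedAddCommGroup F] [InnerProductSpace ℂ F]

lemma continuous_fourier {h : V → F} (hh : Integrable h) : Continuous (𝓕 h) :=
  VectorFourier.fourierIntegral_continuous Real.continuous_fourierChar
    (by simp only [innerₗ_apply_apply]; fun_prop) hh

variable [CompleteSpace F]

lemma integral_fourier_smul_eq {g : V → ℂ} {h : V → F} (hg : Integrable g) (hh : Integrable h) :
    ∫ x, 𝓕 g x • h x = ∫ x, g x • 𝓕 h x := by
  have := VectorFourier.integral_fourierIntegral_smul_eq_flip (μ := volume) (ν := volume)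
    (L := innerₗ V) Real.continuous_fourierChar (by simp only [innerₗ_apply_apply]; fun_prop) hg hh
  rwa [flip_innerₗ] at this

-- Both sides agree as tempered distributions: test them against Schwartz functions.
theorem fourier_toLp_ae_eq {h : V → F} (h₁ : Integrable h) (h₂ : MemLp h 2) :
    (𝓕 (h₂.toLp h) : Lp F 2 (volume : Measure V)) =ᵐ[volume] 𝓕 h := by
  refine ae_eq_of_integral_contDiff_smul_eq ((Lp.memLp _).locallyIntegrable (by norm_num))
    (continuous_fourier h₁).locallyIntegrable fun g hg hgs => ?_
  let G : 𝓢(V, ℂ) := (hgs.comp_left (g := Complex.ofReal) rfl).toSchwartzMap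
    (Complex.ofRealCLM.contDiff.comp hg)
  have hdistrib := congrArg (fun T => T G) (Lp.fourier_toTemperedDistribution_eq (h₂.toLp h))
  simp only [TemperedDistribution.fourier_apply, Lp.toTemperedDistribution_apply] at hdistrib
  calc ∫ x, g x • (𝓕 (h₂.toLp h) : Lp F 2 (volume : Measure V)) x
      = ∫ x, G x • (𝓕 (h₂.toLp h) : Lp F 2 (volume : Measure V)) x := rfl
    _ = ∫ x, (𝓕 G) x • h₂.toLp h x := hdistrib.symm
    _ = ∫ x, 𝓕 (G : V → ℂ) x • h x := by
        refine integral_congr_ae ?_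
        filter_upwards [h₂.coeFn_toLp] with x hx
        rw [hx, SchwartzMap.fourier_coe]
    _ = ∫ x, g x • 𝓕 h x := integral_fourier_smul_eq G.integrable h₁

lemma lintegral_enorm_sq_eq_eLpNorm_sq {α ε : Type*} [MeasurableSpace α] [TopologicalSpace ε]
    [ContinuousENorm ε] (f : α → ε) (μ : Measure α) :
    ∫⁻ x, ‖f x‖ₑ ^ 2 ∂μ = eLpNorm f 2 μ ^ 2 := by
  simpa using (eLpNorm_nnreal_pow_eq_lintegral (μ := μ) (f := f) (two_ne_zero (α := NNReal))).symm

theorem lintegral_enorm_sq_fourier {h : V → F} (h₁ : Integrable h) (h₂ : MemLp h 2) :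
    ∫⁻ x, ‖𝓕 h x‖ₑ ^ 2 = ∫⁻ x, ‖h x‖ₑ ^ 2 := by
  rw [lintegral_enorm_sq_eq_eLpNorm_sq, lintegral_enorm_sq_eq_eLpNorm_sq,
    ← eLpNorm_congr_ae (fourier_toLp_ae_eq h₁ h₂), ← eLpNorm_congr_ae h₂.coeFn_toLp,
    ← Lp.enorm_def, ← Lp.enorm_def, ← ofReal_norm, ← ofReal_norm, Lp.norm_fourier_eq]

end Plancherel

section HilbertSpace

variable {𝕜 E : Type*} [RCLike 𝕜] [NormedAddCommGroup E] [InnerProductSpace 𝕜 E]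

lemma countable_of_orthonormal [TopologicalSpace.SeparableSpace E] {ι : Type*} {v : ι → E}
    (hv : Orthonormal 𝕜 v) : Countable ι := by
  refine Pairwise.countable_of_isOpen_disjoint (s := fun i => Metric.ball (v i) (1 / 2))
    (fun i j hij => Metric.ball_disjoint_ball ?_) (fun i => Metric.isOpen_ball)
    (fun i => Metric.nonempty_ball.2 (by norm_num))
  have hsq : ‖v i - v j‖ ^ 2 = 2 := by
    rw [norm_sub_sq (𝕜 := 𝕜), hv.1, hv.1, hv.2 hij, map_zero]
    norm_num
  rw [dist_eq_norm]
  nlinarith [norm_nonneg (v i - v j)]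

theorem stronglyMeasurable_of_forall_inner [CompleteSpace E] [TopologicalSpace.SeparableSpace E]
    {α : Type*} [MeasurableSpace α] {F : α → E}
    (hF : ∀ x : E, StronglyMeasurable fun a => inner 𝕜 x (F a)) : StronglyMeasurable F := by
  obtain ⟨w, b, -⟩ := exists_hilbertBasis 𝕜 E
  have : Countable w := countable_of_orthonormal b.orthonormal
  refine stronglyMeasurable_of_tendsto (u := atTop)
    (f := fun (s : Finset w) a => ∑ i ∈ s, inner 𝕜 (b i) (F a) • b i)
    (fun s => Finset.stronglyMeasurable_fun_sum _ fun i _ => (hF (b i)).smul_const (b i))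
    (tendsto_pi_nhds.2 fun a => ?_)
  simpa only [HilbertBasis.repr_apply_apply, HasSum,
    SummationFilter.unconditional_filter] using b.hasSum_repr (F a)

lemma tsum_ofReal_mul_enorm_inner_sq {ι : Type*} (b : HilbertBasis ι 𝕜 E) {T : E →L[𝕜] E}
    (hT : (T : E →ₗ[𝕜] E).IsSymmetric) {ν : ι → ℝ} (hν : ∀ i, 0 ≤ ν i)
    (hb : ∀ i, T (b i) = (ν i : 𝕜) • b i) (x : E) :
    ∑' i, ENNReal.ofReal (ν i) * ‖inner 𝕜 (b i) x‖ₑ ^ 2 =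
      ENNReal.ofReal (T.reApplyInnerSelf x) := by
  have hterm : ∀ i, RCLike.re (inner 𝕜 (T x) (b i) * inner 𝕜 (b i) x) =
      ν i * ‖inner 𝕜 (b i) x‖ ^ 2 := fun i => by
    rw [hT.apply_clm, hb, inner_smul_right, mul_assoc, RCLike.re_ofReal_mul, ← inner_conj_symm x,
      RCLike.conj_mul, ← RCLike.ofReal_pow, RCLike.ofReal_re]
  have hsum : HasSum (fun i => ν i * ‖inner 𝕜 (b i) x‖ ^ 2) (T.reApplyInnerSelf x) := by
    simpa only [hterm, ContinuousLinearMap.reApplyInnerSelf_apply] using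
      RCLike.hasSum_re 𝕜 (b.hasSum_inner_mul_inner (T x) x)
  rw [← hsum.tsum_eq, ENNReal.ofReal_tsum_of_nonneg
    (fun i => mul_nonneg (hν i) (by positivity)) hsum.summable]
  simp_rw [ENNReal.ofReal_mul (hν _), ENNReal.ofReal_pow (norm_nonneg _), ofReal_norm]

theorem tsum_enorm_inner_sq {ι : Type*} (b : HilbertBasis ι 𝕜 E) (x : E) :
    ∑' i, ‖inner 𝕜 (b i) x‖ₑ ^ 2 = ‖x‖ₑ ^ 2 := by
  have h := tsum_ofReal_mul_enorm_inner_sq b (T := .id 𝕜 E) LinearMap.IsSymmetric.id (ν := 1)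
    (fun _ => zero_le_one) (by simp) x
  simpa [ContinuousLinearMap.reApplyInnerSelf_apply, inner_self_eq_norm_sq,
    ENNReal.ofReal_pow] using h

theorem toENat_rank_eq_card_of_hilbertBasis {ι : Type*} (b : HilbertBasis ι 𝕜 E) :
    Cardinal.toENat (Module.rank 𝕜 E) = ENat.card ι := by
  cases finite_or_infinite ι
  · have := Fintype.ofFinite ι
    rw [rank_eq_card_basis b.toOrthonormalBasis.toBasis]
    simp
  · rw [ENat.card_eq_top_of_infinite, Cardinal.toENat_eq_top]
    exact Cardinal.aleph0_le_lift.1 <| (Cardinal.aleph0_le_lift.2 (Cardinal.aleph0_le_mk ι)).trans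
      b.orthonormal.linearIndependent.cardinal_lift_le_rank

theorem exists_hilbertBasis_sigma [CompleteSpace E] {ι : Type*} {κ : ι → Type*}
    {W : ι → Submodule 𝕜 E} (hW : OrthogonalFamily 𝕜 (fun i => W i) fun i => (W i).subtypeₗᵢ)
    (hspan : (⨆ i, W i)ᗮ = ⊥) (b : ∀ i, HilbertBasis (κ i) 𝕜 (W i)) :
    ∃ c : HilbertBasis (Σ i, κ i) 𝕜 E, ∀ i, c i = b i.1 i.2 := by
  have hon : Orthonormal 𝕜 fun i : Σ i, κ i => (b i.1 i.2 : E) :=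
    hW.orthonormal_sigma_orthonormal fun i => (b i).orthonormal
  refine ⟨HilbertBasis.mkOfOrthogonalEqBot hon ?_, fun i => by
    rw [HilbertBasis.coe_mkOfOrthogonalEqBot]⟩
  rw [eq_bot_iff, ← hspan, ← Submodule.iInf_orthogonal]
  refine fun x hx => Submodule.mem_iInf _ |>.2 fun i => (Submodule.mem_orthogonal' _ _).2 ?_
  have hzero : (innerSL 𝕜 x).comp (W i).subtypeL = 0 := by
    refine ContinuousLinearMap.ext_on
      (Submodule.dense_iff_topologicalClosure_eq_top.2 (b i).dense_span) ?_
    rintro _ ⟨j, rfl⟩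
    exact (Submodule.mem_orthogonal' _ _).1 hx _ (Submodule.subset_span ⟨⟨i, j⟩, rfl⟩)
  exact fun y hy => DFunLike.congr_fun hzero ⟨y, hy⟩

section Eigenbasis

open Module.End

/-- The number of eigenvalues of `T` in `[lam, ∞)`, counted with (geometric) multiplicity. -/
noncomputable def eigenvalueCountGE (T : E →L[𝕜] E) (lam : ℝ) : ℝ≥0∞ :=
  ∑' μ : Set.Ici lam,
    (Cardinal.toENat (Module.rank 𝕜 (eigenspace (T : E →ₗ[𝕜] E) ((μ : ℝ) : 𝕜))) : ℝ≥0∞)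

lemma orthogonalComplement_iSup_real_eigenspaces_eq_bot [CompleteSpace E]
    {T : E →L[𝕜] E} (hc : IsCompactOperator T) (hT : (T : E →ₗ[𝕜] E).IsSymmetric) :
    (⨆ ν : ℝ, eigenspace (T : E →ₗ[𝕜] E) (ν : 𝕜))ᗮ = ⊥ := by
  rw [eq_bot_iff, ← ContinuousLinearMap.orthogonalComplement_iSup_eigenspaces_eq_bot hc hT]
  refine Submodule.orthogonal_le (iSup_le fun μ => ?_)
  by_cases hμ : eigenspace (T : E →ₗ[𝕜] E) μ = ⊥
  · exact hμ.le.trans bot_le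
  · obtain ⟨ν, rfl⟩ := RCLike.conj_eq_iff_real.1
      (hT.conj_eigenvalue_eq_self (hasEigenvalue_iff.2 hμ))
    exact le_iSup (fun ν : ℝ => eigenspace (T : E →ₗ[𝕜] E) (ν : 𝕜)) ν

theorem exists_eigenbasis.{u} {E : Type u} [NormedAddCommGroup E] [InnerProductSpace 𝕜 E]
    [CompleteSpace E] {T : E →L[𝕜] E} (hc : IsCompactOperator T)
    (hT : (T : E →ₗ[𝕜] E).IsSymmetric) :
    ∃ (ι : Type u) (b : HilbertBasis ι 𝕜 E) (ν : ι → ℝ), (∀ i, T (b i) = (ν i : 𝕜) • b i) ∧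
      ∀ lam, eigenvalueCountGE T lam = ∑' i, (Set.Ici lam).indicator 1 (ν i) := by
  let W (ν : ℝ) : Submodule 𝕜 E := eigenspace (T : E →ₗ[𝕜] E) (ν : 𝕜)
  have (ν : ℝ) : CompleteSpace (W ν) :=
    (ContinuousLinearMap.isClosed_eigenspace T (ν : 𝕜)).completeSpace_coe
  choose κ b _ using fun ν => exists_hilbertBasis 𝕜 (W ν)
  have hW : OrthogonalFamily 𝕜 (fun ν => W ν) fun ν => (W ν).subtypeₗᵢ :=
    hT.orthogonalFamily_eigenspaces.comp RCLike.ofReal_injective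
  obtain ⟨c, hcb⟩ := exists_hilbertBasis_sigma hW
    (orthogonalComplement_iSup_real_eigenspaces_eq_bot hc hT) b
  refine ⟨_, c, Sigma.fst, fun i => ?_, fun lam => ?_⟩
  · rw [hcb]
    exact mem_eigenspace_iff.1 (b i.1 i.2).2
  · rw [eigenvalueCountGE, ENNReal.tsum_sigma', tsum_subtype (Set.Ici lam) fun ν : ℝ =>
      (Cardinal.toENat (Module.rank 𝕜 (eigenspace (T : E →ₗ[𝕜] E) (ν : 𝕜))) : ℝ≥0∞)]
    refine tsum_congr fun ν => ?_
    rw [tsum_congr (g := fun _ : κ ν => (Set.Ici lam).indicator 1 ν) fun _ => rfl,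
      ENNReal.tsum_const]
    by_cases hν : ν ∈ Set.Ici lam
    · simp only [Set.indicator_of_mem hν, Pi.one_apply, mul_one]
      rw [toENat_rank_eq_card_of_hilbertBasis (b ν)]
    · simp only [Set.indicator_of_notMem hν, mul_zero]

end Eigenbasis

end HilbertSpace

section Counting

variable {lam : ℝ}

lemma abs_indicator_Ici_sub_le {x : ℝ} (h0 : 0 < lam) (h1 : lam < 1) (hx : x ∈ Set.Icc 0 1) :
    |(Set.Ici lam).indicator 1 x - x| ≤ (lam * (1 - lam))⁻¹ * (x - x ^ 2) := by
  obtain ⟨hx0, hx1⟩ := hx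
  have h1' : 0 < 1 - lam := sub_pos.2 h1
  rw [inv_mul_eq_div, le_div_iff₀ (by positivity)]
  by_cases hlam : lam ≤ x
  · rw [Set.indicator_of_mem (Set.mem_Ici.2 hlam), Pi.one_apply, abs_of_nonneg (by linarith)]
    nlinarith [mul_nonneg (sub_nonneg.2 hx1) (sub_nonneg.2 hlam),
      mul_nonneg (sub_nonneg.2 hx1) (sq_nonneg lam)]
  · rw [Set.indicator_of_notMem (by simpa using hlam), zero_sub, abs_neg, abs_of_nonneg hx0]
    nlinarith [mul_nonneg hx0 (sub_nonneg.2 (not_le.1 hlam).le), mul_nonneg hx0 h1'.le]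

lemma ofReal_indicator_one {α : Type*} (s : Set α) (a : α) :
    ENNReal.ofReal (s.indicator 1 a) = s.indicator 1 a := by
  by_cases ha : a ∈ s <;> simp [ha]

variable {ι : Type*} {x : ι → ℝ}

lemma tsum_ofReal_sub_sq (hx : ∀ i, x i ∈ Set.Icc 0 1)
    (hsum : ∑' i, ENNReal.ofReal (x i) ≠ ∞) :
    ∑' i, ENNReal.ofReal (x i - x i ^ 2) =
      ∑' i, ENNReal.ofReal (x i) - ∑' i, ENNReal.ofReal (x i) ^ 2 := by
  have hsq : ∀ i, x i ^ 2 ≤ x i := fun i => sq_le (hx i).1 (hx i).2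
  refine ENNReal.eq_sub_of_add_eq (ne_top_of_le_ne_top hsum <| ENNReal.tsum_le_tsum fun i => ?_) ?_
  · rw [← ENNReal.ofReal_pow (hx i).1]
    exact ENNReal.ofReal_le_ofReal (hsq i)
  · rw [← ENNReal.tsum_add]
    refine tsum_congr fun i => ?_
    rw [← ENNReal.ofReal_pow (hx i).1, ← ENNReal.ofReal_add (sub_nonneg.2 (hsq i)) (sq_nonneg _),
      sub_add_cancel]

theorem tsum_indicator_Ici_le (h0 : 0 < lam) (h1 : lam < 1) (hx : ∀ i, x i ∈ Set.Icc 0 1)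
    (hsum : ∑' i, ENNReal.ofReal (x i) ≠ ∞) :
    ∑' i, (Set.Ici lam).indicator 1 (x i) ≤ ∑' i, ENNReal.ofReal (x i) +
      ENNReal.ofReal (lam * (1 - lam))⁻¹ *
        (∑' i, ENNReal.ofReal (x i) - ∑' i, ENNReal.ofReal (x i) ^ 2) := by
  rw [← tsum_ofReal_sub_sq hx hsum, ← ENNReal.tsum_mul_left, ← ENNReal.tsum_add]
  refine ENNReal.tsum_le_tsum fun i => ?_
  rw [← ofReal_indicator_one, ← ENNReal.ofReal_mul (by have := sub_pos.2 h1; positivity)]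
  refine (ENNReal.ofReal_le_ofReal ?_).trans ENNReal.ofReal_add_le
  linarith [(abs_le.1 (abs_indicator_Ici_sub_le h0 h1 (hx i))).2]

theorem tsum_ofReal_le_tsum_indicator_Ici_add (h0 : 0 < lam) (h1 : lam < 1)
    (hx : ∀ i, x i ∈ Set.Icc 0 1) (hsum : ∑' i, ENNReal.ofReal (x i) ≠ ∞) :
    ∑' i, ENNReal.ofReal (x i) ≤ ∑' i, (Set.Ici lam).indicator 1 (x i) +
      ENNReal.ofReal (lam * (1 - lam))⁻¹ *
        (∑' i, ENNReal.ofReal (x i) - ∑' i, ENNReal.ofReal (x i) ^ 2) := by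
  rw [← tsum_ofReal_sub_sq hx hsum, ← ENNReal.tsum_mul_left, ← ENNReal.tsum_add]
  refine ENNReal.tsum_le_tsum fun i => ?_
  rw [← ofReal_indicator_one, ← ENNReal.ofReal_mul (by have := sub_pos.2 h1; positivity)]
  refine (ENNReal.ofReal_le_ofReal ?_).trans ENNReal.ofReal_add_le
  linarith [(abs_le.1 (abs_indicator_Ici_sub_le h0 h1 (hx i))).1]

lemma tendsto_of_le_add_const_mul_one_sub {α : Type*} {l : Filter α} {n d : α → ℝ≥0∞} {c : ℝ≥0∞}
    (hc : c ≠ ∞) (hd : Tendsto d l (nhds 1)) (hle : ∀ᶠ a in l, n a ≤ 1 + c * (1 - d a))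
    (hge : ∀ᶠ a in l, 1 ≤ n a + c * (1 - d a)) : Tendsto n l (nhds 1) := by
  have hdefect : Tendsto (fun a => c * (1 - d a)) l (nhds 0) := by
    simpa using ENNReal.Tendsto.const_mul
      (ENNReal.Tendsto.sub tendsto_const_nhds hd (.inl ENNReal.one_ne_top)) (.inr hc)
  have hlower := ENNReal.Tendsto.sub (tendsto_const_nhds (x := 1)) hdefect (.inl ENNReal.one_ne_top)
  have hupper := (tendsto_const_nhds (x := (1 : ℝ≥0∞))).add hdefect
  rw [tsub_zero] at hlower
  rw [add_zero] at hupper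
  exact tendsto_of_tendsto_of_tendsto_of_le_of_le' hlower hupper
    (hge.mono fun _ => tsub_le_iff_right.2) hle

end Counting

section FrameOperator

open InnerProductSpace

variable {α E : Type*} [MeasurableSpace α] {μ : Measure α}

theorem integral_mem_of_isClosed {𝕜 : Type*} [RCLike 𝕜] [NormedAddCommGroup E] [NormedSpace 𝕜 E]
    [NormedSpace ℝ E] [CompleteSpace E] {V : Submodule 𝕜 E} (hV : IsClosed (V : Set E)) {F : α → E}
    (hF : Integrable F μ) (hFV : ∀ a, F a ∈ V) : ∫ a, F a ∂μ ∈ V := by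
  rw [← Submodule.Quotient.mk_eq_zero, ← V.mkQ_apply, ← V.mkQL_apply,
    ← V.mkQL.integral_comp_comm hF]
  exact integral_eq_zero_of_ae (Eventually.of_forall fun a =>
    (Submodule.Quotient.mk_eq_zero V).2 (hFV a))

theorem isCompactOperator_integral [NormedAddCommGroup E] [NormedSpace ℂ E] [CompleteSpace E]
    {T : α → E →L[ℂ] E} (hT : Integrable T μ) (hc : ∀ a, IsCompactOperator (T a)) :
    IsCompactOperator (∫ a, T a ∂μ : E →L[ℂ] E) :=
  integral_mem_of_isClosed (V := compactOperator (RingHom.id ℂ) E E)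
    isClosed_setOfPred_isCompactOperator hT hc

lemma isCompactOperator_rankOne {𝕜 F : Type*} [RCLike 𝕜] [NormedAddCommGroup E]
    [InnerProductSpace 𝕜 E] [NormedAddCommGroup F] [NormedSpace 𝕜 F] (x : F) (y : E) :
    IsCompactOperator (rankOne 𝕜 x y) :=
  (isCompactOperator_of_locallyCompactSpace_rng
    (ContinuousLinearMap.toSpanSingleton 𝕜 x)).comp_clm (innerSL 𝕜 y)

variable [NormedAddCommGroup E] [InnerProductSpace ℂ E] {F : α → E}

/-- The frame operator `x ↦ ∫ ⟨F a, x⟩ F a dμ(a)` of a family of vectors `F`. It is an integral of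
operators, convergent in operator norm as soon as `F` is square-integrable. -/
noncomputable def frameOperator (F : α → E) (μ : Measure α) : E →L[ℂ] E :=
  ∫ a, rankOne ℂ (F a) (F a) ∂μ

lemma integrable_rankOne_self (hF : MemLp F 2 μ) :
    Integrable (fun a => rankOne ℂ (F a) (F a)) μ := by
  have hcont : Continuous fun x : E => rankOne ℂ x x :=
    ((ContinuousLinearMap.smulRightL ℂ E E).continuous.comp
      (innerSL ℂ).continuous).clm_apply continuous_id
  refine (integrable_norm_iff (hcont.comp_aestronglyMeasurable hF.1)).1 ?_
  simpa only [norm_rankOne, ← sq] using hF.integrable_norm_pow two_ne_zero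

variable [CompleteSpace E]

theorem isCompactOperator_frameOperator (hF : MemLp F 2 μ) :
    IsCompactOperator (frameOperator F μ) :=
  isCompactOperator_integral (integrable_rankOne_self hF) fun _ => isCompactOperator_rankOne _ _

lemma inner_frameOperator (hF : MemLp F 2 μ) (x y : E) :
    inner ℂ x (frameOperator F μ y) = ∫ a, inner ℂ (F a) y * inner ℂ x (F a) ∂μ := by
  have hint := integrable_rankOne_self hF
  rw [frameOperator, ContinuousLinearMap.integral_apply hint,
    ← integral_inner (hint.apply_continuousLinearMap y)]
  simp only [rankOne_apply, inner_smul_right]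

lemma isSymmetric_frameOperator (hF : MemLp F 2 μ) :
    (frameOperator F μ : E →ₗ[ℂ] E).IsSymmetric := fun x y => by
  simp only [ContinuousLinearMap.coe_coe]
  rw [← inner_conj_symm, inner_frameOperator hF, inner_frameOperator hF, ← integral_conj]
  simp only [map_mul, inner_conj_symm, mul_comm]

lemma reApplyInnerSelf_frameOperator (hF : MemLp F 2 μ) (x : E) :
    (frameOperator F μ).reApplyInnerSelf x = ∫ a, ‖inner ℂ (F a) x‖ ^ 2 ∂μ := by
  have hsq : ∀ a, inner ℂ (F a) x * inner ℂ x (F a) = ((‖inner ℂ (F a) x‖ ^ 2 : ℝ) : ℂ) :=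
    fun a => by rw [← inner_conj_symm x, Complex.mul_conj', Complex.ofReal_pow]
  rw [ContinuousLinearMap.reApplyInnerSelf_apply, inner_re_symm, inner_frameOperator hF,
    integral_congr_ae (.of_forall hsq), integral_complex_ofReal, RCLike.re_to_complex,
    Complex.ofReal_re]

lemma ofReal_reApplyInnerSelf_frameOperator (hF : MemLp F 2 μ) (x : E) :
    ENNReal.ofReal ((frameOperator F μ).reApplyInnerSelf x) = ∫⁻ a, ‖inner ℂ (F a) x‖ₑ ^ 2 ∂μ := by
  rw [reApplyInnerSelf_frameOperator hF, ofReal_integral_eq_lintegral_ofReal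
    ((hF.inner_const x).integrable_norm_pow two_ne_zero) (.of_forall fun _ => by positivity)]
  simp_rw [ENNReal.ofReal_pow (norm_nonneg _), ofReal_norm]

section Eigenvalues

variable {ι : Type*} (b : HilbertBasis ι ℂ E) {ν : ι → ℝ}

lemma eigenvalue_eq_integral (hF : MemLp F 2 μ)
    (hb : ∀ i, frameOperator F μ (b i) = (ν i : ℂ) • b i) (i : ι) :
    ν i = ∫ a, ‖inner ℂ (F a) (b i)‖ ^ 2 ∂μ := by
  rw [← reApplyInnerSelf_frameOperator hF, ContinuousLinearMap.reApplyInnerSelf_apply, hb,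
    inner_smul_left, inner_self_eq_norm_sq_to_K, b.orthonormal.1 i]
  simp

lemma ofReal_eigenvalue (hF : MemLp F 2 μ)
    (hb : ∀ i, frameOperator F μ (b i) = (ν i : ℂ) • b i) (i : ι) :
    ENNReal.ofReal (ν i) = ∫⁻ a, ‖inner ℂ (F a) (b i)‖ₑ ^ 2 ∂μ := by
  rw [← ofReal_reApplyInnerSelf_frameOperator hF, reApplyInnerSelf_frameOperator hF,
    eigenvalue_eq_integral b hF hb]

lemma eigenvalue_mem_Icc (hF : MemLp F 2 μ)
    (hbessel : ∀ x, ∫⁻ a, ‖inner ℂ (F a) x‖ₑ ^ 2 ∂μ ≤ ‖x‖ₑ ^ 2)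
    (hb : ∀ i, frameOperator F μ (b i) = (ν i : ℂ) • b i) (i : ι) : ν i ∈ Set.Icc 0 1 := by
  constructor
  · rw [eigenvalue_eq_integral b hF hb]
    positivity
  · rw [← ENNReal.ofReal_le_one, ofReal_eigenvalue b hF hb]
    refine (hbessel (b i)).trans_eq ?_
    rw [← ofReal_norm, b.orthonormal.1 i, ENNReal.ofReal_one, one_pow]

variable [Countable ι]

theorem tsum_eigenvalues (hF : MemLp F 2 μ)
    (hb : ∀ i, frameOperator F μ (b i) = (ν i : ℂ) • b i) :
    ∑' i, ENNReal.ofReal (ν i) = ∫⁻ a, ‖F a‖ₑ ^ 2 ∂μ := by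
  simp_rw [ofReal_eigenvalue b hF hb, ← inner_conj_symm _ (b _), RCLike.enorm_conj]
  rw [← lintegral_tsum fun i => ((hF.1.const_inner (c := b i)).enorm.pow_const 2)]
  simp_rw [tsum_enorm_inner_sq]

theorem tsum_eigenvalues_sq (hF : MemLp F 2 μ)
    (hb : ∀ i, frameOperator F μ (b i) = (ν i : ℂ) • b i) :
    ∑' i, ENNReal.ofReal (ν i) ^ 2 = ∫⁻ a, ∫⁻ c, ‖inner ℂ (F c) (F a)‖ₑ ^ 2 ∂μ ∂μ := by
  have hν : ∀ i, 0 ≤ ν i := fun i => by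
    rw [eigenvalue_eq_integral b hF hb]
    positivity
  calc ∑' i, ENNReal.ofReal (ν i) ^ 2
      = ∑' i, ∫⁻ a, ENNReal.ofReal (ν i) * ‖inner ℂ (b i) (F a)‖ₑ ^ 2 ∂μ := by
        refine tsum_congr fun i => ?_
        rw [lintegral_const_mul' _ _ ENNReal.ofReal_ne_top, sq]
        nth_rw 2 [ofReal_eigenvalue b hF hb]
        simp_rw [← inner_conj_symm _ (b i), RCLike.enorm_conj]
    _ = ∫⁻ a, ∑' i, ENNReal.ofReal (ν i) * ‖inner ℂ (b i) (F a)‖ₑ ^ 2 ∂μ :=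
        (lintegral_tsum fun i =>
          ((hF.1.const_inner (c := b i)).enorm.pow_const 2).const_mul _).symm
    _ = ∫⁻ a, ∫⁻ c, ‖inner ℂ (F c) (F a)‖ₑ ^ 2 ∂μ ∂μ := by
        simp_rw [tsum_ofReal_mul_enorm_inner_sq b (isSymmetric_frameOperator hF) hν hb,
          ofReal_reApplyInnerSelf_frameOperator hF]

end Eigenvalues

section CountBounds

variable [TopologicalSpace.SeparableSpace E] {lam : ℝ}

theorem exists_eigenvalues_frameOperator.{u} {E : Type u} [NormedAddCommGroup E]
    [InnerProductSpace ℂ E] [CompleteSpace E] [TopologicalSpace.SeparableSpace E] {F : α → E}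
    (hF : MemLp F 2 μ) (hbessel : ∀ x, ∫⁻ a, ‖inner ℂ (F a) x‖ₑ ^ 2 ∂μ ≤ ‖x‖ₑ ^ 2) :
    ∃ (ι : Type u) (ν : ι → ℝ), (∀ i, ν i ∈ Set.Icc 0 1) ∧
      ∑' i, ENNReal.ofReal (ν i) = ∫⁻ a, ‖F a‖ₑ ^ 2 ∂μ ∧
      ∑' i, ENNReal.ofReal (ν i) ^ 2 = ∫⁻ a, ∫⁻ c, ‖inner ℂ (F c) (F a)‖ₑ ^ 2 ∂μ ∂μ ∧
      ∀ lam, eigenvalueCountGE (frameOperator F μ) lam =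
        ∑' i, (Set.Ici lam).indicator 1 (ν i) := by
  obtain ⟨ι, b, ν, hb, hcount⟩ :=
    exists_eigenbasis (isCompactOperator_frameOperator hF) (isSymmetric_frameOperator hF)
  have : Countable ι := countable_of_orthonormal b.orthonormal
  exact ⟨ι, ν, eigenvalue_mem_Icc b hF hbessel hb, tsum_eigenvalues b hF hb,
    tsum_eigenvalues_sq b hF hb, hcount⟩

theorem eigenvalueCountGE_frameOperator_le (hF : MemLp F 2 μ)
    (hbessel : ∀ x, ∫⁻ a, ‖inner ℂ (F a) x‖ₑ ^ 2 ∂μ ≤ ‖x‖ₑ ^ 2) (h0 : 0 < lam) (h1 : lam < 1) :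
    eigenvalueCountGE (frameOperator F μ) lam ≤ ∫⁻ a, ‖F a‖ₑ ^ 2 ∂μ +
      ENNReal.ofReal (lam * (1 - lam))⁻¹ *
        (∫⁻ a, ‖F a‖ₑ ^ 2 ∂μ - ∫⁻ a, ∫⁻ c, ‖inner ℂ (F c) (F a)‖ₑ ^ 2 ∂μ ∂μ) := by
  obtain ⟨ι, ν, hν, htrace, hsq, hcount⟩ := exists_eigenvalues_frameOperator hF hbessel
  rw [hcount, ← hsq, ← htrace]
  refine tsum_indicator_Ici_le h0 h1 hν ?_
  rw [htrace, lintegral_enorm_sq_eq_eLpNorm_sq]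
  exact ENNReal.pow_ne_top hF.2.ne

theorem lintegral_enorm_sq_le_eigenvalueCountGE_frameOperator_add (hF : MemLp F 2 μ)
    (hbessel : ∀ x, ∫⁻ a, ‖inner ℂ (F a) x‖ₑ ^ 2 ∂μ ≤ ‖x‖ₑ ^ 2) (h0 : 0 < lam) (h1 : lam < 1) :
    ∫⁻ a, ‖F a‖ₑ ^ 2 ∂μ ≤ eigenvalueCountGE (frameOperator F μ) lam +
      ENNReal.ofReal (lam * (1 - lam))⁻¹ *
        (∫⁻ a, ‖F a‖ₑ ^ 2 ∂μ - ∫⁻ a, ∫⁻ c, ‖inner ℂ (F c) (F a)‖ₑ ^ 2 ∂μ ∂μ) := by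
  obtain ⟨ι, ν, hν, htrace, hsq, hcount⟩ := exists_eigenvalues_frameOperator hF hbessel
  rw [hcount, ← hsq, ← htrace]
  refine tsum_ofReal_le_tsum_indicator_Ici_add h0 h1 hν ?_
  rw [htrace, lintegral_enorm_sq_eq_eLpNorm_sq]
  exact ENNReal.pow_ne_top hF.2.ne

end CountBounds

end FrameOperator

section GaborTransform

open scoped FourierTransform

theorem lintegral_lintegral_mul_translate {G : Type*} [MeasurableSpace G] [AddGroup G]
    [MeasurableAdd₂ G] {μ : Measure G} [SFinite μ] [μ.IsAddLeftInvariant] {u v : G → ℝ≥0∞}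
    (hu : Measurable u) (hv : Measurable v) :
    ∫⁻ s, ∫⁻ t, u t * v (t + s) ∂μ ∂μ = (∫⁻ t, u t ∂μ) * ∫⁻ t, v t ∂μ := by
  rw [lintegral_lintegral_swap (by fun_prop), ← lintegral_mul_const _ hu]
  refine lintegral_congr fun t => ?_
  rw [lintegral_const_mul _ (by fun_prop), lintegral_add_left_eq_self]

lemma gaborTransform_eq_fourier (φ f : SignalSpace) (τ σ : ℝ) :
    gaborTransform φ f (τ, σ) = Complex.exp ((-Real.pi * τ * σ : ℝ) * Complex.I) *
      𝓕 (fun t : ℝ => f t * conj (φ (t + τ))) σ := by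
  rw [gaborTransform, Real.fourier_real_eq_integral_exp_smul, ← integral_const_mul]
  refine integral_congr_ae (Eventually.of_forall fun t => ?_)
  simp only [timeFreqShift, map_mul, smul_eq_mul, ← Complex.exp_conj, Complex.conj_ofReal,
    Complex.conj_I, map_ofNat]
  push_cast
  ring_nf

theorem lintegral_enorm_sq_gaborTransform (φ f : SignalSpace) :
    ∫⁻ p, ‖gaborTransform φ f p‖ₑ ^ 2 = ‖φ‖ₑ ^ 2 * ‖f‖ₑ ^ 2 := by
  have hφ := (Lp.stronglyMeasurable φ).measurable
  have hf := (Lp.stronglyMeasurable f).measurable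
  have hmeas : Measurable fun q : ℝ × ℝ => ‖f q.2 * conj (φ (q.2 + q.1))‖ₑ ^ 2 :=
    ((hf.comp measurable_snd).mul
      (Complex.continuous_conj.measurable.comp (hφ.comp (by fun_prop)))).enorm.pow_const 2
  have hTonelli : ∫⁻ τ : ℝ, ∫⁻ t : ℝ, ‖f t * conj (φ (t + τ))‖ₑ ^ 2 = ‖φ‖ₑ ^ 2 * ‖f‖ₑ ^ 2 := by
    simp only [enorm_mul, mul_pow, RCLike.enorm_conj]
    rw [lintegral_lintegral_mul_translate (hf.enorm.pow_const 2) (hφ.enorm.pow_const 2),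
      lintegral_enorm_sq_eq_eLpNorm_sq, lintegral_enorm_sq_eq_eLpNorm_sq, ← Lp.enorm_def,
      ← Lp.enorm_def, mul_comm]
  have hfin : ∀ᵐ τ : ℝ, ∫⁻ t : ℝ, ‖f t * conj (φ (t + τ))‖ₑ ^ 2 < ∞ := by
    refine ae_lt_top hmeas.lintegral_prod_right' ?_
    rw [hTonelli]
    simp [ENNReal.mul_eq_top]
  rw [← hTonelli, Measure.volume_eq_prod, lintegral_prod _
    ((stronglyMeasurable_gaborTransform φ f).measurable.enorm.pow_const 2).aemeasurable]
  refine lintegral_congr_ae ?_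
  filter_upwards [hfin] with τ hτ
  have hL1 : Integrable fun t : ℝ => f t * conj (φ (t + τ)) := (Lp.memLp f).integrable_mul
    ((Lp.memLp φ).comp_measurePreserving (measurePreserving_add_right volume τ)).star
  have hL2 : MemLp (fun t : ℝ => f t * conj (φ (t + τ))) 2 := by
    rw [lintegral_enorm_sq_eq_eLpNorm_sq] at hτ
    exact ⟨hL1.1, by simpa using hτ⟩
  simp_rw [gaborTransform_eq_fourier, enorm_mul, Complex.enorm_exp_ofReal_mul_I, one_mul]
  rw [lintegral_enorm_sq_fourier hL1 hL2]
  simp_rw [enorm_mul]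

lemma timeFreqShift_eq_exp_mul (τ σ : ℝ) (f : ℝ → ℂ) (t : ℝ) :
    timeFreqShift τ σ f t =
      Complex.exp ((Real.pi * τ * σ + 2 * Real.pi * σ * t : ℝ) * Complex.I) * f (t + τ) := by
  rw [timeFreqShift, ← Complex.exp_add]
  push_cast
  ring_nf

lemma timeFreqShift_mul_conj_timeFreqShift (τ σ : ℝ) (f g : ℝ → ℂ) (t : ℝ) :
    timeFreqShift τ σ f t * conj (timeFreqShift τ σ g t) = f (t + τ) * conj (g (t + τ)) := by
  rw [timeFreqShift_eq_exp_mul, timeFreqShift_eq_exp_mul, map_mul, mul_mul_mul_comm,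
    Complex.mul_conj', Complex.norm_exp_ofReal_mul_I, Complex.ofReal_one, one_pow, one_mul]

lemma timeFreqShift_timeFreqShift (τ σ τ' σ' : ℝ) (f : ℝ → ℂ) (t : ℝ) :
    timeFreqShift τ' σ' (timeFreqShift τ σ f) t =
      Complex.exp ((Real.pi * (σ * τ' - τ * σ') : ℝ) * Complex.I) *
        timeFreqShift (τ + τ') (σ + σ') f t := by
  simp only [timeFreqShift, ← mul_assoc, ← Complex.exp_add, add_right_comm t, add_assoc]
  congr 2
  push_cast
  ring

lemma coeFn_shiftLp (f : SignalSpace) (p : ℝ × ℝ) :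
    shiftLp f p =ᵐ[volume] timeFreqShift p.1 p.2 f :=
  (memLp_timeFreqShift p.1 p.2 f).coeFn_toLp

lemma shiftLp_shiftLp (f : SignalSpace) (p q : ℝ × ℝ) :
    shiftLp (shiftLp f p) q =
      Complex.exp ((Real.pi * (p.2 * q.1 - p.1 * q.2) : ℝ) * Complex.I) • shiftLp f (p + q) := by
  have htranslate := (measurePreserving_add_right volume q.1).quasiMeasurePreserving.ae_eq
    (coeFn_shiftLp f p)
  refine Lp.ext ?_
  filter_upwards [coeFn_shiftLp (shiftLp f p) q, coeFn_shiftLp f (p + q), htranslate,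
    Lp.coeFn_smul (Complex.exp ((Real.pi * (p.2 * q.1 - p.1 * q.2) : ℝ) * Complex.I))
      (shiftLp f (p + q))] with t hpq hadd hp hsmul
  rw [hpq, hsmul, Pi.smul_apply, hadd, smul_eq_mul, Prod.fst_add, Prod.snd_add,
    ← timeFreqShift_timeFreqShift]
  exact congrArg (_ * ·) hp

lemma inner_shiftLp_shiftLp (f g : SignalSpace) (p : ℝ × ℝ) :
    inner ℂ (shiftLp f p) (shiftLp g p) = inner ℂ f g := by
  calc inner ℂ (shiftLp f p) (shiftLp g p)
      = ∫ t, g (t + p.1) * conj (f (t + p.1)) := by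
        refine integral_congr_ae ?_
        filter_upwards [coeFn_shiftLp f p, coeFn_shiftLp g p] with t hf hg
        rw [RCLike.inner_apply, hf, hg, timeFreqShift_mul_conj_timeFreqShift]
    _ = inner ℂ f g := integral_add_right_eq_self (fun t => g t * conj (f t)) p.1

lemma norm_gaborTransform_shiftLp (φ f : SignalSpace) (p q : ℝ × ℝ) :
    ‖gaborTransform φ (shiftLp f p) q‖ = ‖gaborTransform φ f (q - p)‖ := by
  rw [gaborTransform_eq_inner, gaborTransform_eq_inner, ← inner_shiftLp_shiftLp _ f p,
    shiftLp_shiftLp, inner_smul_left, norm_mul, RCLike.norm_conj,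
    Complex.norm_exp_ofReal_mul_I, one_mul, sub_add_cancel]

instance separableSpace_signalSpace : TopologicalSpace.SeparableSpace SignalSpace :=
  have : Fact ((2 : ℝ≥0∞) ≠ ∞) := ⟨ENNReal.ofNat_ne_top⟩
  inferInstance

lemma stronglyMeasurable_shiftLp (φ : SignalSpace) : StronglyMeasurable (shiftLp φ) := by
  refine stronglyMeasurable_of_forall_inner (𝕜 := ℂ) fun x => ?_
  simpa only [Function.comp_def, gaborTransform_eq_inner, inner_conj_symm] using
    Complex.continuous_conj.comp_stronglyMeasurable (stronglyMeasurable_gaborTransform φ x)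

lemma memLp_shiftLp (φ : SignalSpace) (p : ℝ≥0∞) (μ : Measure (ℝ × ℝ)) [IsFiniteMeasure μ] :
    MemLp (shiftLp φ) p μ :=
  MemLp.of_bound (stronglyMeasurable_shiftLp φ).aestronglyMeasurable ‖φ‖
    (Eventually.of_forall fun q => (norm_shiftLp φ q).le)

end GaborTransform

section Dilation

lemma lintegral_lintegral_sub_eq {G : Type*} [MeasurableSpace G] [AddCommGroup G]
    [MeasurableAdd₂ G] [MeasurableSub₂ G] {μ : Measure G} [SFinite μ] [μ.IsAddLeftInvariant]
    {k : G → ℝ≥0∞} (hk : Measurable k) {S : Set G} (hS : MeasurableSet S) :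
    ∫⁻ p in S, ∫⁻ q in S, k (q - p) ∂μ ∂μ = ∫⁻ z, k z * μ (S ∩ (· + z) ⁻¹' S) ∂μ := by
  have : Measurable (S.indicator (1 : G → ℝ≥0∞)) := measurable_one.indicator hS
  have hinner : ∀ p, ∫⁻ q in S, k (q - p) ∂μ = ∫⁻ z, k z * S.indicator 1 (p + z) ∂μ := fun p => by
    rw [← lintegral_indicator hS, ← lintegral_add_left_eq_self _ p]
    refine lintegral_congr fun z => ?_
    by_cases hz : p + z ∈ S <;> simp [hz]
  simp_rw [hinner]
  rw [lintegral_lintegral_swap (by fun_prop)]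
  refine lintegral_congr fun z => ?_
  have hz : MeasurableSet ((· + z) ⁻¹' S) := measurable_add_const z hS
  rw [lintegral_const_mul _ (by fun_prop), Set.inter_comm, ← Measure.restrict_apply hz,
    ← lintegral_indicator_one hz]
  rfl

theorem tendsto_measure_inter_preimage_add {G : Type*} [AddGroup G] [TopologicalSpace G]
    [IsTopologicalAddGroup G] [LocallyCompactSpace G] [MeasurableSpace G] [BorelSpace G]
    {μ : Measure G} [μ.IsAddRightInvariant] [IsLocallyFiniteMeasure μ] [μ.InnerRegularCompactLTTop]
    {S : Set G} (hS : NullMeasurableSet S μ) (hfin : μ S ≠ ∞) :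
    Tendsto (fun z => μ (S ∩ (· + z) ⁻¹' S)) (nhds 0) (nhds (μ S)) := by
  let translate : C(G, C(G, G)) := ContinuousMap.curry ⟨fun x => x.2 + x.1, by fun_prop⟩
  have htranslate : Tendsto translate (nhds 0) (nhds (ContinuousMap.id G)) := by
    rw [← show translate 0 = ContinuousMap.id G from ContinuousMap.ext add_zero]
    exact translate.continuous.tendsto 0
  have hsymmDiff := tendsto_measure_symmDiff_preimage_nhds_zero htranslate
    (.of_forall (measurePreserving_add_right μ)) (.id μ) hS hfin
  have hlower := ENNReal.Tendsto.sub (tendsto_const_nhds (x := μ S)) hsymmDiff (.inl hfin)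
  rw [tsub_zero] at hlower
  refine tendsto_of_tendsto_of_tendsto_of_le_of_le hlower tendsto_const_nhds (fun z => ?_)
    fun z => measure_mono Set.inter_subset_left
  refine tsub_le_iff_right.2 ((measure_mono fun p hp => ?_).trans (measure_union_le _ _))
  by_cases hpz : p + z ∈ S
  · exact .inl ⟨hp, hpz⟩
  · exact .inr (.inr ⟨hp, hpz⟩)

lemma smul_set_inter_preimage_add {K M : Type*} [DivisionRing K] [AddCommGroup M]
    [Module K M] {r : K} (hr : r ≠ 0) (S : Set M) (z : M) :
    r • S ∩ (· + z) ⁻¹' (r • S) = r • (S ∩ (· + r⁻¹ • z) ⁻¹' S) := by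
  ext p
  simp [Set.mem_smul_set_iff_inv_smul_mem₀ hr, smul_add]

variable {V : Type*} [NormedAddCommGroup V] [NormedSpace ℝ V] [FiniteDimensional ℝ V]
  [MeasurableSpace V] [BorelSpace V] {μ : Measure V} [μ.IsAddHaarMeasure] {Ω : Set V}

lemma addHaar_smul_inter_preimage_add_div {r : ℝ} (hr : r ≠ 0) (z : V) :
    μ (r • Ω ∩ (· + z) ⁻¹' (r • Ω)) / μ (r • Ω) = μ (Ω ∩ (· + r⁻¹ • z) ⁻¹' Ω) / μ Ω := by
  rw [smul_set_inter_preimage_add hr Ω, Measure.addHaar_smul, Measure.addHaar_smul]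
  exact ENNReal.mul_div_mul_left _ _ (by simp [hr]) ENNReal.ofReal_ne_top

theorem tendsto_addHaar_smul_inter_preimage_add_div (hΩ : NullMeasurableSet Ω μ) (h0 : μ Ω ≠ 0)
    (hfin : μ Ω ≠ ∞) (z : V) :
    Tendsto (fun r : ℝ => μ (r • Ω ∩ (· + z) ⁻¹' (r • Ω)) / μ (r • Ω)) atTop (nhds 1) := by
  have hshift : Tendsto (fun r : ℝ => r⁻¹ • z) atTop (nhds 0) := by
    simpa only [zero_smul] using (tendsto_inv_atTop_zero (𝕜 := ℝ)).smul_const z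
  have hlim := ENNReal.Tendsto.div_const
    ((tendsto_measure_inter_preimage_add hΩ hfin).comp hshift) (b := μ Ω) (.inr h0)
  rw [ENNReal.div_self h0 hfin] at hlim
  refine hlim.congr' ?_
  filter_upwards [eventually_ne_atTop 0] with r hr
  exact (addHaar_smul_inter_preimage_add_div hr z).symm

theorem tendsto_lintegral_lintegral_smul_sub_div (hΩ : MeasurableSet Ω) (h0 : μ Ω ≠ 0)
    (hfin : μ Ω ≠ ∞) {k : V → ℝ≥0∞} (hk : Measurable k) (hkfin : ∫⁻ z, k z ∂μ ≠ ∞) :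
    Tendsto (fun r : ℝ => (∫⁻ p in r • Ω, ∫⁻ q in r • Ω, k (q - p) ∂μ ∂μ) / μ (r • Ω)) atTop
      (nhds (∫⁻ z, k z ∂μ)) := by
  have hoverlap : ∀ r : ℝ, Measurable fun z => μ (r • Ω ∩ (· + z) ⁻¹' (r • Ω)) := fun r =>
    measurable_measure_prodMk_left (s := {x : V × V | x.2 ∈ r • Ω ∧ x.2 + x.1 ∈ r • Ω})
      ((measurable_snd (hΩ.const_smul₀ r)).inter
        ((measurable_snd.add measurable_fst) (hΩ.const_smul₀ r)))
  have hlim : Tendsto (fun r : ℝ => ∫⁻ z, k z * (μ (r • Ω ∩ (· + z) ⁻¹' (r • Ω)) / μ (r • Ω)) ∂μ)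
      atTop (nhds (∫⁻ z, k z ∂μ)) := by
    refine tendsto_lintegral_filter_of_dominated_convergence k
      (.of_forall fun r => hk.mul ((hoverlap r).div_const _))
      (.of_forall fun r => .of_forall fun z => mul_le_of_le_one_right' ?_) hkfin ?_
    · exact ENNReal.div_le_of_le_mul (by rw [one_mul]; exact measure_mono Set.inter_subset_left)
    · filter_upwards [ae_lt_top hk hkfin] with z hz
      simpa only [mul_one] using ENNReal.Tendsto.const_mul
        (tendsto_addHaar_smul_inter_preimage_add_div hΩ.nullMeasurableSet h0 hfin z) (.inr hz.ne)
  refine hlim.congr fun r => ?_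
  simp_rw [lintegral_lintegral_sub_eq hk (hΩ.const_smul₀ r), div_eq_mul_inv, ← mul_assoc]
  exact lintegral_mul_const _ (hk.mul (hoverlap r))

end Dilation

section ConcentrationOperator

variable {φ : SignalSpace} {Ω : Set (ℝ × ℝ)}

theorem concentrationOp_eq_frameOperator (φ : SignalSpace) (hΩ : volume Ω ≠ ∞) :
    concentrationOp φ Ω = frameOperator (shiftLp φ) (volume.restrict Ω) := by
  have : IsFiniteMeasure (volume.restrict Ω) := isFiniteMeasure_restrict.2 hΩ
  have hform : ∀ f g, inner ℂ g (frameOperator (shiftLp φ) (volume.restrict Ω) f) =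
      concentrationForm φ Ω f g := fun f g => by
    simp only [inner_frameOperator (memLp_shiftLp φ 2 _), concentrationForm,
      gaborTransform_eq_inner, inner_conj_symm]
  have hexists : ∃ C : SignalSpace →L[ℂ] SignalSpace,
      ∀ f g, inner ℂ g (C f) = concentrationForm φ Ω f g := ⟨_, hform⟩
  refine ContinuousLinearMap.ext fun f => ext_inner_left ℂ fun g => ?_
  rw [concentrationOp, dif_pos hexists, hexists.choose_spec, hform]

lemma eigenvalueCount_eq_eigenvalueCountGE (φ : SignalSpace) (hΩ : volume Ω ≠ ∞) (lam : ℝ) :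
    eigenvalueCount φ lam Ω =
      eigenvalueCountGE (frameOperator (shiftLp φ) (volume.restrict Ω)) lam := by
  rw [← concentrationOp_eq_frameOperator φ hΩ]
  rfl

lemma setLIntegral_enorm_inner_shiftLp_sq_le (hφ : ‖φ‖ₑ = 1) (f : SignalSpace) :
    ∫⁻ p in Ω, ‖inner ℂ (shiftLp φ p) f‖ₑ ^ 2 ≤ ‖f‖ₑ ^ 2 := by
  simp_rw [← gaborTransform_eq_inner]
  refine (setLIntegral_le_lintegral _ _).trans_eq ?_
  rw [lintegral_enorm_sq_gaborTransform, hφ, one_pow, one_mul]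

lemma enorm_inner_shiftLp_shiftLp (φ f : SignalSpace) (p q : ℝ × ℝ) :
    ‖inner ℂ (shiftLp φ q) (shiftLp f p)‖ₑ = ‖gaborTransform φ f (q - p)‖ₑ := by
  rw [← gaborTransform_eq_inner, ← ofReal_norm, norm_gaborTransform_shiftLp, ofReal_norm]

lemma setLIntegral_enorm_shiftLp_sq (hφ : ‖φ‖ₑ = 1) :
    ∫⁻ p in Ω, ‖shiftLp φ p‖ₑ ^ 2 = volume Ω := by
  simp_rw [← ofReal_norm, norm_shiftLp, ofReal_norm, hφ, one_pow, setLIntegral_one]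

theorem eigenvalueCount_le (hφ : ‖φ‖ₑ = 1) (hΩ : volume Ω ≠ ∞) {lam : ℝ} (h0 : 0 < lam)
    (h1 : lam < 1) :
    eigenvalueCount φ lam Ω ≤ volume Ω + ENNReal.ofReal (lam * (1 - lam))⁻¹ *
      (volume Ω - ∫⁻ p in Ω, ∫⁻ q in Ω, ‖gaborTransform φ φ (q - p)‖ₑ ^ 2) := by
  have : IsFiniteMeasure (volume.restrict Ω) := isFiniteMeasure_restrict.2 hΩ
  simpa only [eigenvalueCount_eq_eigenvalueCountGE φ hΩ, setLIntegral_enorm_shiftLp_sq hφ,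
    enorm_inner_shiftLp_shiftLp] using eigenvalueCountGE_frameOperator_le (memLp_shiftLp φ 2 _)
      (setLIntegral_enorm_inner_shiftLp_sq_le hφ) h0 h1

theorem volume_le_eigenvalueCount_add (hφ : ‖φ‖ₑ = 1) (hΩ : volume Ω ≠ ∞) {lam : ℝ} (h0 : 0 < lam)
    (h1 : lam < 1) :
    volume Ω ≤ eigenvalueCount φ lam Ω + ENNReal.ofReal (lam * (1 - lam))⁻¹ *
      (volume Ω - ∫⁻ p in Ω, ∫⁻ q in Ω, ‖gaborTransform φ φ (q - p)‖ₑ ^ 2) := by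
  have : IsFiniteMeasure (volume.restrict Ω) := isFiniteMeasure_restrict.2 hΩ
  simpa only [eigenvalueCount_eq_eigenvalueCountGE φ hΩ, setLIntegral_enorm_shiftLp_sq hφ,
    enorm_inner_shiftLp_shiftLp] using
      lintegral_enorm_sq_le_eigenvalueCountGE_frameOperator_add (memLp_shiftLp φ 2 _)
        (setLIntegral_enorm_inner_shiftLp_sq_le hφ) h0 h1

theorem tendsto_lintegral_lintegral_enorm_sq_gaborTransform_div (hφ : ‖φ‖ₑ = 1)
    (hΩ : MeasurableSet Ω) (h0 : volume Ω ≠ 0) (hfin : volume Ω ≠ ∞) :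
    Tendsto (fun r : ℝ => (∫⁻ p in r • Ω, ∫⁻ q in r • Ω, ‖gaborTransform φ φ (q - p)‖ₑ ^ 2) /
      volume (r • Ω)) atTop (nhds 1) := by
  have hmoyal : ∫⁻ p, ‖gaborTransform φ φ p‖ₑ ^ 2 = 1 := by
    rw [lintegral_enorm_sq_gaborTransform, hφ, one_pow, one_mul]
  have hmeas : Measurable fun p => ‖gaborTransform φ φ p‖ₑ ^ 2 :=
    (stronglyMeasurable_gaborTransform φ φ).measurable.enorm.pow_const 2
  simpa only [hmoyal] using
    tendsto_lintegral_lintegral_smul_sub_div hΩ h0 hfin hmeas (by simp [hmoyal])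

theorem mainTheorem1_general (φ : SignalSpace) (hφ : ‖φ‖ = 1) {Ω : Set (ℝ × ℝ)}
    (hmeas : MeasurableSet Ω) (h0 : volume Ω ≠ 0) (hfin : volume Ω ≠ ∞) {lam : ℝ}
    (hlam0 : 0 < lam) (hlam1 : lam < 1) :
    Tendsto (fun r : ℝ => eigenvalueCount φ lam (r • Ω) / volume (r • Ω)) atTop (nhds 1) := by
  have hφ' : ‖φ‖ₑ = 1 := by rw [← ofReal_norm, hφ, ENNReal.ofReal_one]
  have hr0 : ∀ r : ℝ, r ≠ 0 → volume (r • Ω) ≠ 0 := fun r hr => by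
    simp [Measure.addHaar_smul, hr, h0]
  have hrfin : ∀ r : ℝ, volume (r • Ω) ≠ ∞ := fun r => by
    rw [Measure.addHaar_smul]
    exact ENNReal.mul_ne_top ENNReal.ofReal_ne_top hfin
  refine tendsto_of_le_add_const_mul_one_sub (c := ENNReal.ofReal (lam * (1 - lam))⁻¹)
    ENNReal.ofReal_ne_top
    (tendsto_lintegral_lintegral_enorm_sq_gaborTransform_div hφ' hmeas h0 hfin) ?_ ?_
  · filter_upwards [eventually_ne_atTop 0] with r hr
    have hcount := ENNReal.div_le_div_right (eigenvalueCount_le hφ' (hrfin r) hlam0 hlam1)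
      (volume (r • Ω))
    rwa [ENNReal.add_div, mul_div_assoc, ENNReal.sub_div fun _ _ => hr0 r hr,
      ENNReal.div_self (hr0 r hr) (hrfin r)] at hcount
  · filter_upwards [eventually_ne_atTop 0] with r hr
    have harea := ENNReal.div_le_div_right
      (volume_le_eigenvalueCount_add hφ' (hrfin r) hlam0 hlam1) (volume (r • Ω))
    rwa [ENNReal.add_div, mul_div_assoc, ENNReal.sub_div fun _ _ => hr0 r hr,
      ENNReal.div_self (hr0 r hr) (hrfin r)] at harea

end ConcentrationOperator

theorem mainTheorem1 (φ : SignalSpace) (hφ : ‖φ‖ = 1)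
    (Ω : Set (ℝ × ℝ)) (hbdd : Bornology.IsBounded Ω) (hmeas : MeasurableSet Ω)
    (hpos : 0 < volume Ω) (lam : ℝ) (hlam0 : 0 < lam) (hlam1 : lam < 1) :
    Filter.liminf
      (fun r : ℝ => eigenvalueCount φ lam (r • Ω) / volume (r • Ω)) Filter.atTop = 1 :=
  (mainTheorem1_general φ hφ hmeas hpos.ne' hbdd.measure_lt_top.ne hlam0 hlam1).liminf_eq
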